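/- Let $\Gamma$ be a locally compact second countable (Hausdorff) group, $(X,\mathcal X,m)$ a standard probability space, $T:X\to X$ an invertible measure preserving transformation and $w:X\to\Gamma$ a measurable map. Let $w_n(x)$, $n\in\mathbb Z$, be the cocycle with $w_0=1$, $w_n(x)=w(T^{n-1}x)\cdots w(Tx)w(x)$ and $w_{-n}(x)=w_n(T^{-n}x)^{-1}$ for $n>0$. Let $m^1_\Gamma$ be a probability measure on $\Gamma$ in the class of the Haar measure, and let $\widetilde m^1$ on $\Gamma^{\mathbb Z}$ be the push-forward of $m\times m_\Gamma^1$ under $(x,g)\mapsto (w_n(x)g^{-1})_{n\in\mathbb Z}$. Let $\widetilde m^1_+$ and $\widetilde m^1_-$ be its marginals on $\Gamma^{\{n\ge 0\}}$ and $\Gamma^{\{n<0\}}$, and let $\beta_+$ and $\beta_-$ be the factor maps from these spaces to the Lebesgue spaces $(E_+,\eta_+)$ and $(E_-,\eta_-)$ of ergodic components of the shifts $(\gamma_n)\mapsto(\gamma_{n+1})$ and $(\gamma_n)\mapsto(\gamma_{n-1})$, respectively, that is, the factors corresponding to the $\sigma$-algebras of shift-invariant sets (modulo null sets). Assume that $(X,m,T,w,\Gamma)$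 is Apafic, i.e. that the push-forward of $\widetilde m^1$ to $E_+\times E_-$ under $\beta_+\times\beta_-$ (precomposed with the restrictions to future and past) is equivalent to $\eta_+\times\eta_-$. Let $p_+:(X,m)\to (X_+,m_+)$ and $p_-:(X,m)\to(X_-,m_-)$ be the factors corresponding to the $\sigma$-algebras generated by $\{w\circ T^k: k\ge 0\}$ and by $\{w\circ T^{k}: k\le -1\}$, and let $m=\int_{X_+}\mu_y\,dm_+(y)$ be the disintegration of $m$ along $p_+$. Let $M$ be a compact metrizable space with a continuous action of $\Gamma$, and let $\operatorname{Prob}(M)$ be the space of Borel probability measures on $M$ with the push-forward action; integrals of $\operatorname{Prob}(M)$-valued maps are barycenters. A measurable map $\psi:X_+\to\operatorname{Prob}(M)$ is called stationary if $$\psi(y)=\int_X w(T^{-1}x).\psi(p_+(T^{-1}x))\,d\mu_y(x)\quad\text{for } m_+\text{-a.e. } y\in X_+,$$ and a stationary map $\psi$ is called past-oriented if there is a measurable map $\phi:X_-\to\operatorname{Prob}(M)$ with $\phi(p_-(x))=w(T^{-1}x).\phi(p_-(T^{-1}x))$ for $m$-a.e. $x\in X$ and $\psi(y)=\int_X\phi(p_-(x))\,d\mu_y(x)$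 for $m_+$-a.e. $y\in X_+$. If $M$ has no non-empty finite $\Gamma$-invariant subset, then for every past-oriented stationary map $\psi:X_+\to\operatorname{Prob}(M)$ and for $m_+$-a.e. $y\in X_+$, the measure $\psi(y)$ has no atoms. -/

import Mathlib

open MeasureTheory ProbabilityTheory Set

noncomputable section

/-- A group random element generator (Greg): an invertible measure preserving transformation `T` of
a standard probability space `(X, m)` with a measurable map `w` into a group `Γ`. -/
structure Greg (X Γ : Type*) [MeasurableSpace X] [StandardBorelSpace X] [MeasurableSpace Γ] where
  m : Measure X
  isProbabilityMeasure : IsProbabilityMeasure m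
  T : X ≃ᵐ X
  measurePreserving : MeasurePreserving T m m
  w : X → Γ
  measurable_w : Measurable w

attribute [instance] Greg.isProbabilityMeasure

/-- The (non-invertible) shift on one-sided sequences. -/
def seqShift {Γ : Type*} (y : ℕ → Γ) : ℕ → Γ := fun k => y (k + 1)

/-- `π : (Ω, μ) → E` is the space of ergodic components of the semigroup generated by `S`: it is the
factor of `(Ω, μ)` that corresponds to the σ-algebra of the `S`-invariant measurable sets
(everything modulo null sets). The measure of `E` is `μ.map π`. -/
structure IsErgodicComponents {Ω E : Type*} [MeasurableSpace Ω] [MeasurableSpace E]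
    (S : Ω → Ω) (μ : Measure Ω) (π : Ω → E) : Prop where
  measurable : Measurable π
  invariant_iff : ∀ A : Set Ω, MeasurableSet A →
    (S ⁻¹' A =ᵐ[μ] A ↔ ∃ B : Set E, MeasurableSet B ∧ A =ᵐ[μ] π ⁻¹' B)

/-- The future part `(γ₀, γ₁, γ₂, …)` of a two-sided sequence. -/
def futurePart {Γ : Type*} (γ : ℤ → Γ) : ℕ → Γ := fun k => γ (k : ℤ)

/-- The past part `(γ₋₁, γ₋₂, γ₋₃, …)` of a two-sided sequence. -/
def pastPart {Γ : Type*} (γ : ℤ → Γ) : ℕ → Γ := fun k => γ (-((k : ℤ) + 1))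

namespace Greg

variable {X Γ : Type*} [MeasurableSpace X] [StandardBorelSpace X] [MeasurableSpace Γ]

theorem nonempty (G : Greg X Γ) : Nonempty X :=
  haveI : NeZero G.m := ⟨IsProbabilityMeasure.ne_zero G.m⟩
  G.m.nonempty_of_neZero

section Cocycle

variable [Group Γ]

/-- `w_n(x) = w(T^{n-1} x) ⋯ w(T x) w(x)` for `n ≥ 0`. -/
def natCocycle (G : Greg X Γ) : ℕ → X → Γ
  | 0, _ => 1
  | n + 1, x => G.w (G.T^[n] x) * G.natCocycle n x

/-- The cocycle `w_n(x)`, `n ∈ ℤ`; for `n > 0`,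
`w_{-n}(x) = w_n(T^{-n} x)⁻¹ = w(T^{-n} x)⁻¹ ⋯ w(T^{-1} x)⁻¹`. -/
def cocycle (G : Greg X Γ) : ℤ → X → Γ
  | Int.ofNat n, x => G.natCocycle n x
  | Int.negSucc n, x => (G.natCocycle (n + 1) (G.T.symm^[n + 1] x))⁻¹

/-- `j(x, g) = (w_n(x) g⁻¹)_{n ∈ ℤ}`. -/
def walk (G : Greg X Γ) (p : X × Γ) : ℤ → Γ := fun n => G.cocycle n p.1 * p.2⁻¹

/-- The law `j_*(m × κ)` of the driven random walk, where `κ` is a measure on `Γ`. -/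
def walkLaw (G : Greg X Γ) (κ : Measure Γ) : Measure (ℤ → Γ) := (G.m.prod κ).map G.walk

/-- The asymptotic past and future independence condition. Here `κ` is a probability measure in the
Haar class, `Ep` and `Em` are the spaces of ideal futures and pasts, that is, the
ergodic components of the shifts on `Γ^{ℤ₊}` and `Γ^{ℤ₋}`, and the law of (ideal future, ideal past)
is equivalent to the product of its marginals. -/
def IsApafic [TopologicalSpace Γ] [IsTopologicalGroup Γ] [LocallyCompactSpace Γ] [BorelSpace Γ]
    (G : Greg X Γ) : Prop :=
  ∃ (κ : Measure Γ) (Ep Em : Type) (_ : MeasurableSpace Ep) (_ : MeasurableSpace Em)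
    (βp : (ℕ → Γ) → Ep) (βm : (ℕ → Γ) → Em),
    IsProbabilityMeasure κ ∧ κ ≪ Measure.haar ∧ Measure.haar ≪ κ ∧
    StandardBorelSpace Ep ∧ StandardBorelSpace Em ∧
    IsErgodicComponents seqShift ((G.walkLaw κ).map futurePart) βp ∧
    IsErgodicComponents seqShift ((G.walkLaw κ).map pastPart) βm ∧
    (G.walkLaw κ).map (fun γ => (βp (futurePart γ), βm (pastPart γ))) ≪
      (((G.walkLaw κ).map futurePart).map βp).prod (((G.walkLaw κ).map pastPart).map βm) ∧
    (((G.walkLaw κ).map futurePart).map βp).prod (((G.walkLaw κ).map pastPart).map βm) ≪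
      (G.walkLaw κ).map (fun γ => (βp (futurePart γ), βm (pastPart γ)))

end Cocycle

/-- The factor map `p₊ : X → X₊`, `p₊(x) = (w(x), w(T x), w(T² x), …)`, which generates the
σ-algebra of the future. The space `X₊` is `ℕ → Γ`, and the induced map `T₊` is `seqShift`. -/
def toFuture (G : Greg X Γ) (x : X) : ℕ → Γ := fun k => G.w (G.T^[k] x)

/-- The factor map `p₋ : X → X₋`, `p₋(x) = (w(T⁻¹ x), w(T⁻² x), …)`, which generates the
σ-algebra of the past. The space `X₋` is `ℕ → Γ`, and the induced map `T₋` is `seqShift`. -/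
def toPast (G : Greg X Γ) (x : X) : ℕ → Γ := fun k => G.w (G.T.symm^[k + 1] x)

/-- The measure `m₊` of `X₊`. -/
def futureMeasure (G : Greg X Γ) : Measure (ℕ → Γ) := G.m.map G.toFuture

/-- The measure `m₋` of `X₋`. -/
def pastMeasure (G : Greg X Γ) : Measure (ℕ → Γ) := G.m.map G.toPast

/-- The disintegration `y ↦ μ_y` of `m` along `p₊ : X → X₊`. -/
def disintegration (G : Greg X Γ) : Kernel (ℕ → Γ) X :=
  haveI := G.nonempty
  condDistrib id G.toFuture G.m

end Greg

section Measures

variable {M : Type*} [TopologicalSpace M] [MeasurableSpace M] [BorelSpace M]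

/-- `ν` is the barycenter `∫ F(x) dμ(x)` of the `Prob(M)`-valued map `F`, tested on the continuous
functions on `M`. -/
def IsBarycenter {Ω : Type*} [MeasurableSpace Ω] (μ : Measure Ω) (F : Ω → ProbabilityMeasure M)
    (ν : ProbabilityMeasure M) : Prop :=
  ∀ f : C(M, ℝ), ∫ ξ, f ξ ∂(ν : Measure M) = ∫ x, (∫ ξ, f ξ ∂(F x : Measure M)) ∂μ

/-- The action of a group element on probability measures by push-forward. -/
def translateProb {Γ : Type*} [Group Γ] [TopologicalSpace Γ] [MulAction Γ M] [ContinuousSMul Γ M]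
    (γ : Γ) (ν : ProbabilityMeasure M) : ProbabilityMeasure M :=
  ν.map (f := fun ξ : M => γ • ξ) (continuous_const_smul γ).measurable.aemeasurable

end Measures

namespace Greg

variable {X Γ : Type*} [MeasurableSpace X] [StandardBorelSpace X] [MeasurableSpace Γ]
  [Group Γ] [TopologicalSpace Γ]
  {M : Type*} [TopologicalSpace M] [MeasurableSpace M] [BorelSpace M]
  [MulAction Γ M] [ContinuousSMul Γ M]

/-- `ψ ∈ Map^stat(X₊, Prob(M))`: `ψ(y) = ∫ w(T⁻¹ x).ψ(p₊(T⁻¹ x)) dμ_y(x)` for almost every `y`. -/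
structure IsStationary (G : Greg X Γ) (ψ : (ℕ → Γ) → ProbabilityMeasure M) : Prop where
  measurable : Measurable ψ
  stationary : ∀ᵐ y ∂G.futureMeasure, IsBarycenter (G.disintegration y)
    (fun x => translateProb (G.w (G.T.symm x)) (ψ (G.toFuture (G.T.symm x)))) (ψ y)

/-- `φ ∈ Map_w(X₋, Prob(M))`: `φ(p₋(x)) = w(T⁻¹ x).φ(p₋(T⁻¹ x))` for almost every `x`; the zeroth
entry of `p₋(x)` is `w(T⁻¹ x)`. -/
structure IsPastEquivariant (G : Greg X Γ) (φ : (ℕ → Γ) → ProbabilityMeasure M) : Prop where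
  measurable : Measurable φ
  equivariant : ∀ᵐ z ∂G.pastMeasure, φ z = translateProb (z 0) (φ (seqShift z))

/-- `ψ ∈ Map^stat_-(X₊, Prob(M))`: the stationary map `ψ` corresponds to a map
`φ ∈ Map_w(X₋, Prob(M))`, that is, `ψ(y) = ∫ φ(p₋(x)) dμ_y(x)` for almost every `y`. -/
structure IsPastOriented (G : Greg X Γ) (ψ : (ℕ → Γ) → ProbabilityMeasure M) : Prop where
  isStationary : G.IsStationary ψ
  exists_past : ∃ φ : (ℕ → Γ) → ProbabilityMeasure M, G.IsPastEquivariant φ ∧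
    ∀ᵐ y ∂G.futureMeasure, IsBarycenter (G.disintegration y) (fun x => φ (G.toPast x)) (ψ y)

end Greg

end

/-!
The measure `ψ(y)` is a conditional expectation of `φ(p₋(x))` given the future, so its atoms are
seen both from the future and from the past; asymptotic independence allows the past to be moved by
an independent random group element, and B. H. Neumann's lemma says that this destroys all
coincidences of atoms.

In detail, let `⟨μ, ν⟩ = ∑ ξ, μ{ξ} ν{ξ}` be the `ℓ²` pairing of the atomic parts of two measures on
`M` (`SubProb.pairing`), which is invariant under the diagonal action of `Γ`.

* By stationarity `ψ(p₊(x))` is the conditional expectation of `w(T⁻¹x).ψ(p₊(T⁻¹x))` given the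
  future, and both have the same mean square `ℓ²` norm. Hence their atomic parts agree, and the
  atomic part of `ψ` is equivariant (`Greg.IsStationary.atoms_seqShift`). In terms of the driven
  random walk, `g.ψ(p₊(x))` has an atomic part that depends on the ideal future only, and
  `g.φ(p₋(x))` depends on the ideal past only.
* The function `I(x) = ⟨ψ(p₊(x)), φ(p₋(x))⟩` is therefore `T`-invariant, and a martingale argument
  shows that it is a function of the future
  (`Greg.IsStationary.exists_pairing_eq_comp_toFuture`), thus of the ideal future. In this way the
  ergodicity of `T` need not be discussed.
* The joint law of ideal future and ideal past dominates the product of its marginals. So the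
  relation between `I` and the two ideal maps persists for independent copies of the future and of
  the past: `⟨g.ψ(p₊(x)), g'.φ(p₋(x'))⟩ = I(x)` for almost all `x`, `g`, `x'`, `g'`
  (`Greg.IsApafic.exists_pairing_translate_eq`).
* Since `M` has no finite invariant set, all orbits are infinite, and the left side is arbitrarily
  small for `g'` in some non-empty open set (`SubProb.exists_isOpen_pairing_translate_le`). So
  `I = 0` almost everywhere. But the integral of `I` is that of `⟨ψ(y), ψ(y)⟩`, because `ψ(y)` is
  the barycenter of the measures `φ(p₋(x))`; hence `ψ(y)` has no atoms.
-/

noncomputable section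

open scoped ENNReal

/-! ### Atoms of measures of mass at most one -/

theorem ENNReal.two_mul_mul_le_add_mul_self (a b : ℝ≥0∞) : 2 * (a * b) ≤ a * a + b * b := by
  rcases eq_or_ne a ∞ with rfl | ha
  · simp
  rcases eq_or_ne b ∞ with rfl | hb
  · simp
  lift a to NNReal using ha
  lift b to NNReal using hb
  norm_cast
  rw [← NNReal.coe_le_coe]
  push_cast
  nlinarith [sq_nonneg ((a : ℝ) - b)]

theorem ENNReal.eq_of_add_mul_self_le {a b : ℝ≥0∞} (ha : a ≠ ∞) (hb : b ≠ ∞)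
    (h : a * a + b * b ≤ 2 * (a * b)) : a = b := by
  lift a to NNReal using ha
  lift b to NNReal using hb
  norm_cast at h ⊢
  rw [← NNReal.coe_le_coe] at h
  push_cast at h
  rw [← NNReal.coe_inj]
  nlinarith [sq_nonneg ((a : ℝ) - b)]

/-- Measures of total mass at most one. They are needed besides probability measures because the
atomic part of a probability measure may lose mass; the uniform bound makes the tautological kernel
on this space finite, so that integrals depend measurably on the measure. -/
abbrev SubProb (M : Type*) [MeasurableSpace M] := {μ : Measure M // μ univ ≤ 1}

namespace SubProb

section Atoms

variable {M : Type*} [MeasurableSpace M]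

instance (μ : SubProb M) : IsFiniteMeasure μ.1 := ⟨μ.2.trans_lt ENNReal.one_lt_top⟩

/-- The tautological kernel from measures of mass at most one. -/
def kernel (M : Type*) [MeasurableSpace M] : Kernel (SubProb M) M :=
  ⟨Subtype.val, measurable_subtype_coe⟩

instance : IsFiniteKernel (kernel M) := ⟨1, ENNReal.one_lt_top, fun μ => μ.2⟩

/-- A probability measure as a measure of mass at most one. -/
def ofProb (μ : ProbabilityMeasure M) : SubProb M := ⟨μ, by simp⟩

@[simp] theorem ofProb_val (μ : ProbabilityMeasure M) : (ofProb μ).1 = (μ : Measure M) := rfl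

theorem measurable_ofProb : Measurable (ofProb : ProbabilityMeasure M → SubProb M) :=
  measurable_subtype_coe.subtype_mk

/-- The `ℓ²` pairing of the atomic parts of two measures. -/
def pairing (μ ν : SubProb M) : ℝ≥0∞ := ∑' ξ, μ.1 {ξ} * ν.1 {ξ}

theorem pairing_congr {μ μ' ν ν' : SubProb M} (h : ∀ ξ, μ.1 {ξ} = μ'.1 {ξ})
    (h' : ∀ ξ, ν.1 {ξ} = ν'.1 {ξ}) : pairing μ ν = pairing μ' ν' := by
  simp only [pairing, h, h']

theorem pairing_comm (μ ν : SubProb M) : pairing μ ν = pairing ν μ := by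
  simp only [pairing, mul_comm]

theorem pairing_self_add (μ ν : SubProb M) :
    pairing μ μ + pairing ν ν = ∑' ξ, (μ.1 {ξ} * μ.1 {ξ} + ν.1 {ξ} * ν.1 {ξ}) :=
  ENNReal.tsum_add.symm

theorem two_mul_pairing (μ ν : SubProb M) :
    2 * pairing μ ν = ∑' ξ, 2 * (μ.1 {ξ} * ν.1 {ξ}) :=
  ENNReal.tsum_mul_left.symm

theorem two_mul_pairing_le (μ ν : SubProb M) :
    2 * pairing μ ν ≤ pairing μ μ + pairing ν ν := by
  rw [pairing_self_add, two_mul_pairing]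
  exact ENNReal.tsum_le_tsum fun ξ => ENNReal.two_mul_mul_le_add_mul_self _ _

variable [MeasurableSingletonClass M]

theorem countable_atoms (μ : SubProb M) : {ξ | μ.1 {ξ} ≠ 0}.Countable := by
  have := Measure.countable_meas_pos_of_disjoint_iUnion (μ := μ.1) (As := fun ξ : M => {ξ})
    (fun ξ => measurableSet_singleton ξ) (fun a b hab => by simpa [Function.onFun] using hab)
  simpa only [pos_iff_ne_zero] using this

theorem finite_large_atoms (μ : SubProb M) {ε : ℝ≥0∞} (hε : 0 < ε) :
    {ξ | ε ≤ μ.1 {ξ}}.Finite :=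
  Measure.finite_const_le_meas_of_disjoint_iUnion μ.1 hε (As := fun ξ : M => {ξ})
    (fun ξ => measurableSet_singleton ξ) (fun a b hab => by simpa [Function.onFun] using hab)
    (measure_ne_top _ _)

theorem lintegral_singleton_mass (μ ν : SubProb M) : ∫⁻ ξ, ν.1 {ξ} ∂μ.1 = pairing μ ν := by
  have hC := countable_atoms ν
  rw [← setLIntegral_eq_of_support_subset (s := {ξ | ν.1 {ξ} ≠ 0}) fun ξ h => h,
    lintegral_countable _ hC, pairing]
  simp only [mul_comm (μ.1 _)]
  refine tsum_subtype_eq_of_support_subset (f := fun ξ => ν.1 {ξ} * μ.1 {ξ}) fun ξ h => ?_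
  exact left_ne_zero_of_mul h

theorem pairing_le_one (μ ν : SubProb M) : pairing μ ν ≤ 1 := by
  rw [← lintegral_singleton_mass]
  calc ∫⁻ ξ, ν.1 {ξ} ∂μ.1 ≤ ∫⁻ _, 1 ∂μ.1 :=
        lintegral_mono fun ξ => (measure_mono (subset_univ _)).trans ν.2
    _ ≤ 1 := by simpa using μ.2

theorem pairing_ne_top (μ ν : SubProb M) : pairing μ ν ≠ ∞ :=
  ((pairing_le_one μ ν).trans_lt ENNReal.one_lt_top).ne

/-- The equality case of the arithmetic-geometric mean inequality `two_mul_pairing_le`. -/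
theorem singleton_eq_of_pairing_eq {μ ν : SubProb M}
    (h : 2 * pairing μ ν = pairing μ μ + pairing ν ν) (ξ : M) : μ.1 {ξ} = ν.1 {ξ} := by
  refine ENNReal.eq_of_add_mul_self_le (measure_ne_top _ _) (measure_ne_top _ _)
    (not_lt.1 fun hlt => h.not_lt ?_)
  have hfin : 2 * pairing μ ν ≠ ∞ := ENNReal.mul_ne_top (by simp) (pairing_ne_top μ ν)
  rw [two_mul_pairing] at hfin ⊢
  rw [pairing_self_add]
  exact ENNReal.tsum_lt_tsum hfin (fun ξ => ENNReal.two_mul_mul_le_add_mul_self _ _) hlt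

/-- Measures without large atoms in common have a small pairing. -/
theorem pairing_le_of_disjoint {μ ν : SubProb M} {ε : ℝ≥0∞}
    (h : ∀ ξ, ε ≤ μ.1 {ξ} → ν.1 {ξ} < ε) : pairing μ ν ≤ 2 * ε := by
  have tsum_le (ρ : SubProb M) : ∑' ξ, ρ.1 {ξ} ≤ 1 := by
    have hC := countable_atoms ρ
    calc ∑' ξ, ρ.1 {ξ} = ∑' ξ : {ξ | ρ.1 {ξ} ≠ 0}, ρ.1 {ξ.1} :=
          (tsum_subtype_eq_of_support_subset (f := fun ξ => ρ.1 {ξ}) (fun ξ h => h)).symm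
      _ = ρ.1 {ξ | ρ.1 {ξ} ≠ 0} := by
          simpa using (lintegral_countable (μ := ρ.1) (fun _ => 1) hC).symm
      _ ≤ 1 := (measure_mono (subset_univ _)).trans ρ.2
  calc pairing μ ν ≤ ∑' ξ, (ε * μ.1 {ξ} + ε * ν.1 {ξ}) := ENNReal.tsum_le_tsum fun ξ => by
        rcases le_or_gt ε (μ.1 {ξ}) with hξ | hξ
        · rw [mul_comm]
          exact (mul_le_mul_left (h ξ hξ).le _).trans le_self_add
        · exact (mul_le_mul_left hξ.le _).trans le_add_self
    _ = ε * (∑' ξ, μ.1 {ξ}) + ε * ∑' ξ, ν.1 {ξ} := by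
        rw [ENNReal.tsum_add, ENNReal.tsum_mul_left, ENNReal.tsum_mul_left]
    _ ≤ ε * 1 + ε * 1 := by gcongr <;> exact tsum_le _
    _ = 2 * ε := by ring

/-- The atomic part of a measure. -/
def atoms (μ : SubProb M) : SubProb M :=
  ⟨μ.1.restrict {ξ | μ.1 {ξ} ≠ 0}, (Measure.restrict_apply_le _ _).trans μ.2⟩

theorem atoms_singleton (μ : SubProb M) (ξ : M) : μ.atoms.1 {ξ} = μ.1 {ξ} := by
  rw [atoms, Measure.restrict_apply (measurableSet_singleton ξ)]
  by_cases h : μ.1 {ξ} = 0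
  · exact (measure_mono_null inter_subset_left h).trans h.symm
  · rw [inter_eq_left.2 (singleton_subset_iff.2 h)]

/-- The atomic part is determined by the masses of the points. -/
theorem atoms_congr {μ ν : SubProb M} (h : ∀ ξ, μ.1 {ξ} = ν.1 {ξ}) : μ.atoms = ν.atoms := by
  refine Subtype.ext (Measure.ext fun s hs => ?_)
  have hC : {ξ | μ.1 {ξ} ≠ 0} = {ξ | ν.1 {ξ} ≠ 0} := by simp only [h]
  have hc : (s ∩ {ξ | μ.1 {ξ} ≠ 0}).Countable := (countable_atoms μ).mono inter_subset_right
  simp only [atoms]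
  rw [Measure.restrict_apply hs, Measure.restrict_apply hs, ← hC,
    ← biUnion_of_singleton (s ∩ {ξ | μ.1 {ξ} ≠ 0}),
    measure_biUnion hc (fun a _ b _ hab => by simpa [Function.onFun] using hab)
      (fun ξ _ => measurableSet_singleton ξ),
    measure_biUnion hc (fun a _ b _ hab => by simpa [Function.onFun] using hab)
      (fun ξ _ => measurableSet_singleton ξ)]
  simp only [h]

end Atoms

section Measurability

variable {M : Type*} [MeasurableSpace M] [TopologicalSpace M] [BorelSpace M]
  [SecondCountableTopology M] [T2Space M]

theorem measurable_singleton : Measurable fun p : SubProb M × M => p.1.1 {p.2} := by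
  have h : MeasurableSet {q : (SubProb M × M) × M | q.2 = q.1.2} :=
    measurableSet_eq_fun measurable_snd (measurable_snd.comp measurable_fst)
  have := Kernel.measurable_kernel_prodMk_left (κ := (kernel M).comap Prod.fst measurable_fst) h
  exact this

theorem measurable_pairing : Measurable fun p : SubProb M × SubProb M => pairing p.1 p.2 := by
  simp only [← lintegral_singleton_mass]
  exact Measurable.lintegral_kernel_prod_right (κ := (kernel M).comap Prod.fst measurable_fst)
    (f := fun (p : SubProb M × SubProb M) ξ => p.2.1 {ξ})
    (measurable_singleton.comp
      ((measurable_snd.comp measurable_fst).prodMk measurable_snd))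

theorem measurable_atoms : Measurable (atoms : SubProb M → SubProb M) := by
  refine Measurable.subtype_mk (Measure.measurable_of_measurable_coe _ fun s hs => ?_)
  simp only [Measure.restrict_apply hs]
  have h : MeasurableSet {q : SubProb M × M | q.2 ∈ s ∧ q.1.1 {q.2} ≠ 0} :=
    (measurable_snd hs).inter (measurable_singleton (measurableSet_singleton 0).compl)
  exact Kernel.measurable_kernel_prodMk_left (κ := kernel M) h

end Measurability

section Translate

variable {Γ M : Type*} [Group Γ] [TopologicalSpace Γ] [TopologicalSpace M] [MeasurableSpace M]
  [BorelSpace M] [MulAction Γ M] [ContinuousSMul Γ M]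

/-- The push-forward under the action of a group element. -/
def translate (g : Γ) (μ : SubProb M) : SubProb M :=
  ⟨μ.1.map (g • ·), by
    rw [Measure.map_apply (measurable_const_smul g) MeasurableSet.univ]
    exact μ.2⟩

theorem translate_apply (g : Γ) (μ : SubProb M) {s : Set M} (hs : MeasurableSet s) :
    (translate g μ).1 s = μ.1 ((g • ·) ⁻¹' s) :=
  Measure.map_apply (continuous_const_smul g).measurable hs

theorem ofProb_translateProb (g : Γ) (μ : ProbabilityMeasure M) :
    ofProb (translateProb g μ) = translate g (ofProb μ) := rfl

theorem translate_mul (g h : Γ) (μ : SubProb M) :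
    translate (g * h) μ = translate g (translate h μ) := by
  refine Subtype.ext ?_
  simp only [translate]
  rw [Measure.map_map (continuous_const_smul g).measurable (continuous_const_smul h).measurable]
  simp only [Function.comp_def, mul_smul]

theorem translate_singleton [T1Space M] (g : Γ) (μ : SubProb M) (ξ : M) :
    (translate g μ).1 {ξ} = μ.1 {g⁻¹ • ξ} := by
  rw [translate_apply g μ (measurableSet_singleton ξ)]
  congr 1
  ext ζ
  simp [eq_inv_smul_iff]

theorem pairing_translate [T1Space M] (g : Γ) (μ ν : SubProb M) :
    pairing (translate g μ) (translate g ν) = pairing μ ν := by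
  simp only [pairing, translate_singleton]
  exact (MulAction.toPerm g⁻¹ : Equiv.Perm M).tsum_eq fun ξ => μ.1 {ξ} * ν.1 {ξ}

theorem atoms_translate [T1Space M] (g : Γ) (μ : SubProb M) :
    (translate g μ).atoms = translate g μ.atoms := by
  have hT : Measurable (g • · : M → M) := (continuous_const_smul g).measurable
  refine Subtype.ext (Measure.ext fun s hs => ?_)
  rw [translate_apply g _ hs]
  simp only [atoms]
  rw [Measure.restrict_apply hs, Measure.restrict_apply (hT hs), translate_apply g μ
    (hs.inter (countable_atoms (translate g μ)).measurableSet)]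
  congr 1
  ext ξ
  simp [translate_singleton]

theorem measurable_translate [SecondCountableTopology M] [MeasurableSpace Γ] [BorelSpace Γ]
    [SecondCountableTopology Γ] :
    Measurable fun p : Γ × SubProb M => translate p.1 p.2 := by
  refine Measurable.subtype_mk (Measure.measurable_of_measurable_coe _ fun s hs => ?_)
  simp only [Measure.map_apply (continuous_const_smul _).measurable hs]
  have h : MeasurableSet {q : (Γ × SubProb M) × M | q.1.1 • q.2 ∈ s} :=
    ((measurable_fst.comp measurable_fst).smul measurable_snd) hs
  exact Kernel.measurable_kernel_prodMk_left (κ := (kernel M).comap Prod.snd measurable_snd) h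

end Translate

end SubProb

/-! ### Separating finite sets by a group element -/

section Separation

variable {Γ M : Type*} [Group Γ] [MulAction Γ M]

/-- B. H. Neumann: if all orbits are infinite, then a finite set can be moved off any finite set.
Otherwise the group is a finite union of cosets of stabilizers, one of which has finite index. -/
theorem exists_smul_notMem_of_infinite_orbits
    (h : ∀ ξ : M, (MulAction.orbit Γ ξ).Infinite) {A B : Set M} (hA : A.Finite) (hB : B.Finite) :
    ∃ g : Γ, ∀ ξ ∈ A, g • ξ ∉ B := by
  classical
  by_contra! hcon
  choose a ha hab using hcon
  let t : M × M → Γ := fun p => if hp : ∃ g : Γ, g • p.1 = p.2 then hp.choose else 1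
  obtain ⟨p, -, hp⟩ := Subgroup.exists_finiteIndex_of_leftCoset_cover
    (s := (hA.prod hB).toFinset) (g := t) (H := fun p => MulAction.stabilizer Γ p.1) (by
      refine eq_univ_of_forall fun g => mem_iUnion₂.2 ⟨(a g, g • a g), ?_, ?_⟩
      · simpa using ⟨ha g, hab g⟩
      · have hex : ∃ g' : Γ, g' • a g = g • a g := ⟨g, rfl⟩
        have ht : t (a g, g • a g) • a g = g • a g := by
          simp only [t, dif_pos hex]
          exact hex.choose_spec
        rw [mem_leftCoset_iff]
        simp [MulAction.mem_stabilizer_iff, mul_smul, inv_smul_eq_iff, ht])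
  refine hp.index_ne_zero ?_
  rw [MulAction.index_stabilizer]
  exact (h p.1).ncard

theorem infinite_orbit_of_no_finite_invariant
    (hM : ¬ ∃ F : Set M, F.Finite ∧ F.Nonempty ∧ ∀ γ : Γ, ∀ ξ ∈ F, γ • ξ ∈ F) (ξ : M) :
    (MulAction.orbit Γ ξ).Infinite := fun hfin =>
  hM ⟨_, hfin, MulAction.nonempty_orbit ξ, fun γ _ hζ => MulAction.mem_orbit_of_mem_orbit γ hζ⟩

/-- The group elements that move the large atoms of `ν` off those of `μ` form a non-empty open
set. -/
theorem SubProb.exists_isOpen_pairing_translate_le [TopologicalSpace Γ] [TopologicalSpace M]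
    [T1Space M] [MeasurableSpace M] [BorelSpace M] [ContinuousSMul Γ M]
    (h : ∀ ξ : M, (MulAction.orbit Γ ξ).Infinite) (μ ν : SubProb M) {ε : ℝ≥0∞} (hε : 0 < ε) :
    ∃ U : Set Γ, IsOpen U ∧ U.Nonempty ∧ ∀ g ∈ U, pairing μ (translate g ν) ≤ 2 * ε := by
  have hA := finite_large_atoms ν hε
  have hB := finite_large_atoms μ hε
  refine ⟨{g | ∀ ξ ∈ {ξ | ε ≤ ν.1 {ξ}}, g • ξ ∉ {ξ | ε ≤ μ.1 {ξ}}}, ?_,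
    exists_smul_notMem_of_infinite_orbits h hA hB, fun g hg => ?_⟩
  · simp only [ofPred_forall]
    exact hA.isOpen_biInter fun ξ _ =>
      hB.isClosed.isOpen_compl.preimage (continuous_id.smul continuous_const)
  · refine pairing_le_of_disjoint fun ξ hξ => ?_
    rw [translate_singleton]
    refine not_le.1 fun hle => hg _ hle ?_
    simpa using hξ

end Separation

/-! ### Invariant maps factor through the space of ergodic components -/

section ErgodicComponents

variable {Ω Ω₁ Ω₂ E₁ E₂ Z₁ Z₂ : Type*} [MeasurableSpace Ω] [MeasurableSpace Ω₁]
  [MeasurableSpace Ω₂] [MeasurableSpace E₁] [MeasurableSpace E₂] [MeasurableSpace Z₁]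
  [MeasurableSpace Z₂]

theorem IsErgodicComponents.exists_preimage_ae_eq {S : Ω₁ → Ω₁} {μ : Measure Ω₁} {π : Ω₁ → E₁}
    (h : IsErgodicComponents S μ π) {u : Ω₁ → Z₁} (hu : Measurable u)
    (hS : ∀ᵐ ω ∂μ, u (S ω) = u ω) {B : Set Z₁} (hB : MeasurableSet B) :
    ∃ B' : Set E₁, MeasurableSet B' ∧ ∀ᵐ ω ∂μ, u ω ∈ B ↔ π ω ∈ B' := by
  obtain ⟨B', hB', hBB'⟩ := (h.invariant_iff (u ⁻¹' B) (hu hB)).1 (by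
    filter_upwards [hS] with ω hω
    exact congrArg (· ∈ B) hω)
  exact ⟨B', hB', hBB'.mono fun ω hω => iff_of_eq hω⟩

/-- Let the joint law of the two ergodic components dominate the product of the marginals. If a
measurable relation between an invariant map of the first variable and an invariant map of the
second one holds almost surely, then it holds almost everywhere for the product of the marginals.
The set `D` need not come from the spaces of ergodic components; it does so up to null sets, by
induction on the product σ-algebra. -/
theorem ae_prod_of_ae_of_isErgodicComponents {P : Measure Ω} [IsProbabilityMeasure P]
    {a : Ω → Ω₁} {b : Ω → Ω₂} (ha : Measurable a) (hb : Measurable b)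
    {S₁ : Ω₁ → Ω₁} {S₂ : Ω₂ → Ω₂} {π₁ : Ω₁ → E₁} {π₂ : Ω₂ → E₂}
    (h₁ : IsErgodicComponents S₁ (P.map a) π₁) (h₂ : IsErgodicComponents S₂ (P.map b) π₂)
    (hac : ((P.map a).map π₁).prod ((P.map b).map π₂) ≪ P.map fun ω => (π₁ (a ω), π₂ (b ω)))
    {u₁ : Ω₁ → Z₁} {u₂ : Ω₂ → Z₂} (hu₁ : Measurable u₁) (hu₂ : Measurable u₂)
    (hS₁ : ∀ᵐ ω ∂P.map a, u₁ (S₁ ω) = u₁ ω) (hS₂ : ∀ᵐ ω ∂P.map b, u₂ (S₂ ω) = u₂ ω)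
    {D : Set (Z₁ × Z₂)} (hD : MeasurableSet D) (h : ∀ᵐ ω ∂P, (u₁ (a ω), u₂ (b ω)) ∈ D) :
    ∀ᵐ p ∂(P.map a).prod (P.map b), (u₁ p.1, u₂ p.2) ∈ D := by
  have := Measure.isProbabilityMeasure_map (μ := P) ha.aemeasurable
  have := Measure.isProbabilityMeasure_map (μ := P) hb.aemeasurable
  have key : ∃ D' : Set (E₁ × E₂), MeasurableSet D' ∧
      (∀ᵐ p ∂(P.map a).prod (P.map b), (u₁ p.1, u₂ p.2) ∈ D ↔ (π₁ p.1, π₂ p.2) ∈ D') ∧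
      ∀ᵐ ω ∂P, (u₁ (a ω), u₂ (b ω)) ∈ D ↔ (π₁ (a ω), π₂ (b ω)) ∈ D' := by
    clear h
    rw [← generateFrom_prod] at hD
    induction D, hD using MeasurableSpace.generateFrom_induction with
    | hC D hD _ =>
      obtain ⟨B₁, hB₁, B₂, hB₂, rfl⟩ := hD
      obtain ⟨B₁', hB₁', h₁'⟩ := h₁.exists_preimage_ae_eq hu₁ hS₁ hB₁
      obtain ⟨B₂', hB₂', h₂'⟩ := h₂.exists_preimage_ae_eq hu₂ hS₂ hB₂
      refine ⟨B₁' ×ˢ B₂', hB₁'.prod hB₂', ?_, ?_⟩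
      · filter_upwards [Measure.quasiMeasurePreserving_fst.ae h₁',
          Measure.quasiMeasurePreserving_snd.ae h₂'] with p hp₁ hp₂
        exact and_congr hp₁ hp₂
      · filter_upwards [ae_of_ae_map ha.aemeasurable h₁', ae_of_ae_map hb.aemeasurable h₂']
          with ω hω₁ hω₂
        exact and_congr hω₁ hω₂
    | empty => exact ⟨∅, MeasurableSet.empty, by simp, by simp⟩
    | compl D _ ih =>
      obtain ⟨D', hD', h, h'⟩ := ih
      exact ⟨D'ᶜ, hD'.compl, h.mono fun _ hp => not_congr hp, h'.mono fun _ hp => not_congr hp⟩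
    | iUnion D _ ih =>
      choose D' hD' h h' using ih
      refine ⟨⋃ n, D' n, MeasurableSet.iUnion hD', ?_, ?_⟩
      · filter_upwards [ae_all_iff.2 h] with p hp
        simp only [mem_iUnion, hp]
      · filter_upwards [ae_all_iff.2 h'] with p hp
        simp only [mem_iUnion, hp]
  obtain ⟨D', hD', hprod, hP⟩ := key
  have hmeas : Measurable fun ω => (π₁ (a ω), π₂ (b ω)) :=
    (h₁.measurable.comp ha).prodMk (h₂.measurable.comp hb)
  have hD'ae : ∀ᵐ e ∂P.map fun ω => (π₁ (a ω), π₂ (b ω)), e ∈ D' := by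
    refine (ae_map_iff hmeas.aemeasurable hD').2 ?_
    filter_upwards [h, hP] with ω hω hω'
    exact hω'.1 hω
  have hpull := hac.ae_le hD'ae
  rw [Measure.map_prod_map _ _ h₁.measurable h₂.measurable] at hpull
  filter_upwards [hprod, ae_of_ae_map
    (h₁.measurable.prodMap h₂.measurable).aemeasurable hpull] with p hp hp'
  exact hp.2 hp'

end ErgodicComponents

/-! ### Invariant functions of the whole process are functions of the future -/

section InvariantFunctions

open Filter
open scoped Topology

/-- If `p ∘ T` is a function of `p`, then a `T`-invariant function that is measurable with respect
to the σ-algebra generated by all `p ∘ T⁻ⁿ` is already a function of `p`. By Lévy's upward theorem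
the function is approximated in `L¹` by functions of `p ∘ T⁻ⁿ`, and by invariance these can be
moved by `Tⁿ` to functions of `p` without changing the error. -/
theorem exists_ae_eq_comp_of_invariant {X Y : Type*} [MeasurableSpace X] [MeasurableSpace Y]
    {m : Measure X} [IsProbabilityMeasure m] {T : X ≃ᵐ X} (hT : MeasurePreserving T m m)
    {p : X → Y} (hp : Measurable p) {S : Y → Y} (hS : Measurable S)
    (hpT : ∀ x, p (T x) = S (p x)) {f : X → ℝ} (hf : Integrable f m)
    (hfT : ∀ᵐ x ∂m, f (T x) = f x)
    (hfm : Measurable[⨆ n : ℕ, MeasurableSpace.comap (fun x => p (T.symm^[n] x)) inferInstance] f) :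
    ∃ h : Y → ℝ, Measurable h ∧ ∀ᵐ x ∂m, f x = h (p x) := by
  have hTn (n : ℕ) : MeasurePreserving (T^[n]) m m := hT.iterate n
  have hq (n : ℕ) : Measurable fun x => p (T.symm^[n] x) :=
    hp.comp (T.symm.measurable.iterate n)
  let F : Filtration ℕ (inferInstance : MeasurableSpace X) :=
    { seq := fun n => MeasurableSpace.comap (fun x => p (T.symm^[n] x)) inferInstance
      mono' := monotone_nat_of_le_succ fun n => by
        have : (fun x => p (T.symm^[n] x)) = S ∘ fun x => p (T.symm^[n + 1] x) := by
          funext x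
          rw [Function.comp, ← hpT, Function.iterate_succ_apply', T.apply_symm_apply]
        rw [this, ← MeasurableSpace.comap_comp]
        exact MeasurableSpace.comap_mono hS.comap_le
      le' := fun n => (hq n).comap_le }
  have hlim := hf.tendsto_eLpNorm_condExp (ℱ := F) hfm.stronglyMeasurable
  have hfac (n : ℕ) : ∃ h : Y → ℝ, Measurable h ∧ m[f|F n] = h ∘ fun x => p (T.symm^[n] x) :=
    Measurable.exists_eq_measurable_comp stronglyMeasurable_condExp.measurable
  choose h hhm hh using hfac
  have hfTn (n : ℕ) : ∀ᵐ x ∂m, f (T^[n] x) = f x := by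
    induction n with
    | zero => simp
    | succ n ih =>
      filter_upwards [ih, (hTn n).quasiMeasurePreserving.ae hfT] with x hx hx'
      rw [Function.iterate_succ_apply', hx', hx]
  have hinv (n : ℕ) (x : X) : T.symm^[n] (T^[n] x) = x :=
    (Function.LeftInverse.iterate (T.symm_apply_apply) n) x
  have hnorm (n : ℕ) : eLpNorm ((fun x => h n (p x)) - f) 1 m = eLpNorm (m[f|F n] - f) 1 m := by
    have h1 : AEStronglyMeasurable (m[f|F n] - f) m :=
      (integrable_condExp.sub hf).aestronglyMeasurable
    rw [← eLpNorm_comp_measurePreserving h1 (hTn n)]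
    refine eLpNorm_congr_ae ?_
    filter_upwards [hfTn n] with x hx
    simp only [Pi.sub_apply, Function.comp, hh n, hx, hinv]
  simp only [← hnorm] at hlim
  obtain ⟨ns, -, hns⟩ := (tendstoInMeasure_of_tendsto_eLpNorm one_ne_zero
    (fun n => ((hhm n).comp hp).aestronglyMeasurable) hf.aestronglyMeasurable
    hlim).exists_seq_tendsto_ae
  refine ⟨fun y => limsup (fun i => h (ns i) y) atTop, Measurable.limsup fun i => hhm _, ?_⟩
  filter_upwards [hns] with x hx
  exact hx.limsup_eq.symm

end InvariantFunctions

/-! ### The future and the past of the driven random walk -/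

namespace Greg

variable {X Γ : Type*} [MeasurableSpace X] [StandardBorelSpace X] [MeasurableSpace Γ]

theorem measurable_toFuture (G : Greg X Γ) : Measurable G.toFuture :=
  measurable_pi_lambda _ fun k => G.measurable_w.comp (G.T.measurable.iterate k)

theorem measurable_toPast (G : Greg X Γ) : Measurable G.toPast :=
  measurable_pi_lambda _ fun k => G.measurable_w.comp (G.T.symm.measurable.iterate (k + 1))

theorem toFuture_T (G : Greg X Γ) (x : X) : G.toFuture (G.T x) = seqShift (G.toFuture x) := rfl

theorem toFuture_zero (G : Greg X Γ) (x : X) : G.toFuture x 0 = G.w x := rfl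

theorem toPast_T_zero (G : Greg X Γ) (x : X) : G.toPast (G.T x) 0 = G.w x := by
  simp [toPast]

theorem seqShift_toPast_T (G : Greg X Γ) (x : X) : seqShift (G.toPast (G.T x)) = G.toPast x := by
  funext k
  simp [seqShift, toPast, Function.iterate_succ_apply]

theorem measurable_seqShift : Measurable (seqShift : (ℕ → Γ) → ℕ → Γ) :=
  measurable_pi_lambda _ fun k => measurable_pi_apply (k + 1)

theorem measurable_futurePart : Measurable (futurePart : (ℤ → Γ) → ℕ → Γ) :=
  measurable_pi_lambda _ fun _ => measurable_pi_apply _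

theorem measurable_pastPart : Measurable (pastPart : (ℤ → Γ) → ℕ → Γ) :=
  measurable_pi_lambda _ fun _ => measurable_pi_apply _

/-- Both the future and the past belong to the σ-algebra generated by the shifted futures. -/
theorem measurable_toFuture_iSup (G : Greg X Γ) :
    Measurable[⨆ n : ℕ, MeasurableSpace.comap (fun x => G.toFuture (G.T.symm^[n] x)) inferInstance]
      G.toFuture :=
  (comap_measurable (fun x => G.toFuture (G.T.symm^[0] x))).mono
    (le_iSup (fun n : ℕ =>
      MeasurableSpace.comap (fun x => G.toFuture (G.T.symm^[n] x)) inferInstance) 0) le_rfl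

theorem measurable_toPast_iSup (G : Greg X Γ) :
    Measurable[⨆ n : ℕ, MeasurableSpace.comap (fun x => G.toFuture (G.T.symm^[n] x)) inferInstance]
      G.toPast :=
  @measurable_pi_lambda _ _ _ (_) _ _ fun k =>
    ((measurable_pi_apply 0).comp
      (comap_measurable (fun x => G.toFuture (G.T.symm^[k + 1] x)))).mono
    (le_iSup (fun n : ℕ =>
      MeasurableSpace.comap (fun x => G.toFuture (G.T.symm^[n] x)) inferInstance) (k + 1)) le_rfl

variable [Group Γ]

theorem natCocycle_succ' (G : Greg X Γ) (n : ℕ) (x : X) :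
    G.natCocycle (n + 1) x = G.natCocycle n (G.T x) * G.w x := by
  induction n with
  | zero => simp [natCocycle]
  | succ n ih => rw [natCocycle, ih, natCocycle, ← mul_assoc, Function.iterate_succ_apply]

theorem futurePart_walk (G : Greg X Γ) (p : X × Γ) (k : ℕ) :
    futurePart (G.walk p) k = G.natCocycle k p.1 * p.2⁻¹ := rfl

theorem pastPart_walk (G : Greg X Γ) (p : X × Γ) (k : ℕ) :
    pastPart (G.walk p) k = (G.natCocycle (k + 1) (G.T.symm^[k + 1] p.1))⁻¹ * p.2⁻¹ := by
  have h : -((k : ℤ) + 1) = Int.negSucc k := rfl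
  simp only [pastPart, h]
  rfl

/-- The increments of a future path. -/
def futureIncrements (γ : ℕ → Γ) : ℕ → Γ := fun k => γ (k + 1) * (γ k)⁻¹

/-- The increments of a past path, which is listed backwards in time. -/
def pastIncrements (γ : ℕ → Γ) : ℕ → Γ := fun k => γ k * (γ (k + 1))⁻¹

theorem futureIncrements_walk (G : Greg X Γ) (p : X × Γ) :
    futureIncrements (futurePart (G.walk p)) = G.toFuture p.1 := by
  funext k
  simp only [futureIncrements, futurePart_walk, natCocycle, toFuture]
  group

theorem pastIncrements_walk (G : Greg X Γ) (p : X × Γ) :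
    pastIncrements (pastPart (G.walk p)) = G.toPast (G.T.symm p.1) := by
  funext k
  simp only [pastIncrements, pastPart_walk, toPast]
  rw [natCocycle_succ' G (k + 1) (G.T.symm^[k + 1 + 1] p.1),
    Function.iterate_succ_apply' G.T.symm (k + 1) p.1, G.T.apply_symm_apply,
    ← Function.iterate_succ_apply' G.T.symm (k + 1) p.1,
    Function.iterate_succ_apply G.T.symm (k + 1) p.1, mul_inv_rev]
  simp

theorem pastPart_walk_zero (G : Greg X Γ) (p : X × Γ) :
    (pastPart (G.walk p) 0)⁻¹ = p.2 * G.w (G.T.symm p.1) := by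
  simp [pastPart_walk, natCocycle]

variable [MeasurableMul₂ Γ]

theorem measurable_natCocycle (G : Greg X Γ) (n : ℕ) : Measurable (G.natCocycle n) := by
  induction n with
  | zero => exact measurable_const
  | succ n ih => exact (G.measurable_w.comp (G.T.measurable.iterate n)).mul ih

variable [MeasurableInv Γ]

theorem measurable_futureIncrements : Measurable (futureIncrements : (ℕ → Γ) → ℕ → Γ) :=
  measurable_pi_lambda _ fun k => (measurable_pi_apply (k + 1)).mul (measurable_pi_apply k).inv

theorem measurable_pastIncrements : Measurable (pastIncrements : (ℕ → Γ) → ℕ → Γ) :=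
  measurable_pi_lambda _ fun k => (measurable_pi_apply k).mul (measurable_pi_apply (k + 1)).inv

theorem measurable_walk (G : Greg X Γ) : Measurable G.walk := by
  refine measurable_pi_lambda _ fun n => Measurable.mul ?_ measurable_snd.inv
  cases n with
  | ofNat n => exact (G.measurable_natCocycle n).comp measurable_fst
  | negSucc n =>
    exact (((G.measurable_natCocycle (n + 1)).comp
      (G.T.symm.measurable.iterate (n + 1))).comp measurable_fst).inv

end Greg

/-! ### Barycenters and conditional expectations -/

section Barycenter

variable {M : Type*} [TopologicalSpace M] [TopologicalSpace.MetrizableSpace M]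
  [MeasurableSpace M] [BorelSpace M]

theorem IsBarycenter.eq_bind {Ω : Type*} [MeasurableSpace Ω] {μ : Measure Ω}
    [IsProbabilityMeasure μ] {N : Ω → ProbabilityMeasure M} (hN : Measurable N)
    {ν : ProbabilityMeasure M} (h : IsBarycenter μ N ν) :
    (ν : Measure M) = μ.bind fun x => (N x : Measure M) := by
  let := TopologicalSpace.metrizableSpaceMetric M
  let κ : Kernel Ω M := ⟨fun x => (N x : Measure M), measurable_subtype_coe.comp hN⟩
  have : IsMarkovKernel κ := ⟨fun x => (N x).2⟩
  change (ν : Measure M) = κ ∘ₘ μ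
  rw [Measure.comp_eq_comp_const_apply]
  refine ext_of_forall_integral_eq_of_IsFiniteMeasure fun f => ?_
  rw [Kernel.integral_comp (f.integrable _), Kernel.const_apply]
  exact h f.toContinuousMap

variable {X Γ : Type*} [MeasurableSpace X] [StandardBorelSpace X] [MeasurableSpace Γ]

instance (G : Greg X Γ) : IsMarkovKernel G.disintegration := by
  have := G.nonempty
  unfold Greg.disintegration
  infer_instance

/-- The barycenter property of `ψ` extends from continuous functions on `M` to measurable functions
that may depend on the future as well: `ψ(p₊(x))` acts as the conditional expectation of `N x` given
the future. -/
theorem Greg.lintegral_of_isBarycenter (G : Greg X Γ) {N : X → ProbabilityMeasure M}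
    (hN : Measurable N) {ψ : (ℕ → Γ) → ProbabilityMeasure M} (hψ : Measurable ψ)
    (h : ∀ᵐ y ∂G.futureMeasure, IsBarycenter (G.disintegration y) N (ψ y))
    {F : (ℕ → Γ) → M → ℝ≥0∞} (hF : Measurable (Function.uncurry F)) :
    ∫⁻ x, ∫⁻ ξ, F (G.toFuture x) ξ ∂(N x : Measure M) ∂G.m =
      ∫⁻ x, ∫⁻ ξ, F (G.toFuture x) ξ ∂(ψ (G.toFuture x) : Measure M) ∂G.m := by
  have := G.nonempty
  let κN : Kernel X M := ⟨fun x => (N x : Measure M), measurable_subtype_coe.comp hN⟩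
  have : IsMarkovKernel κN := ⟨fun x => (N x).2⟩
  let κψ : Kernel (ℕ → Γ) M := ⟨fun y => (ψ y : Measure M), measurable_subtype_coe.comp hψ⟩
  have : IsMarkovKernel κψ := ⟨fun x => (ψ x).2⟩
  have hp := G.measurable_toFuture
  have : IsProbabilityMeasure G.futureMeasure :=
    Measure.isProbabilityMeasure_map hp.aemeasurable
  have hL : Measurable fun q : (ℕ → Γ) × X => ∫⁻ ξ, F q.1 ξ ∂(N q.2 : Measure M) :=
    Measurable.lintegral_kernel_prod_right (κ := κN.comap Prod.snd measurable_snd)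
      (f := fun (q : (ℕ → Γ) × X) ξ => F q.1 ξ)
      (hF.comp ((measurable_fst.comp measurable_fst).prodMk measurable_snd))
  have hR : Measurable fun y => ∫⁻ ξ, F y ξ ∂(ψ y : Measure M) :=
    Measurable.lintegral_kernel_prod_right (κ := κψ) (f := F) hF
  calc ∫⁻ x, ∫⁻ ξ, F (G.toFuture x) ξ ∂(N x : Measure M) ∂G.m
      = ∫⁻ q, ∫⁻ ξ, F q.1 ξ ∂(N q.2 : Measure M) ∂(G.m.map fun x => (G.toFuture x, id x)) :=
        (lintegral_map hL (hp.prodMk measurable_id)).symm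
    _ = ∫⁻ q, ∫⁻ ξ, F q.1 ξ ∂(N q.2 : Measure M) ∂(G.futureMeasure ⊗ₘ G.disintegration) := by
        rw [Greg.futureMeasure, Greg.disintegration, compProd_map_condDistrib (by fun_prop)]
    _ = ∫⁻ y, ∫⁻ x, ∫⁻ ξ, F y ξ ∂(N x : Measure M) ∂(G.disintegration y) ∂G.futureMeasure :=
        Measure.lintegral_compProd hL
    _ = ∫⁻ y, ∫⁻ ξ, F y ξ ∂(ψ y : Measure M) ∂G.futureMeasure := by
        refine lintegral_congr_ae ?_
        filter_upwards [h] with y hy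
        rw [hy.eq_bind hN]
        exact (Measure.lintegral_bind (measurable_subtype_coe.comp hN).aemeasurable
          (hF.comp measurable_prodMk_left).aemeasurable).symm
    _ = _ := lintegral_map hR hp

end Barycenter

/-! ### Equivariance of the atomic part of a stationary map -/

namespace Greg

open SubProb

variable {X Γ : Type*} [MeasurableSpace X] [StandardBorelSpace X] [MeasurableSpace Γ]
  [Group Γ] [TopologicalSpace Γ] [BorelSpace Γ] [SecondCountableTopology Γ]
  {M : Type*} [TopologicalSpace M] [CompactSpace M] [TopologicalSpace.MetrizableSpace M]
  [MeasurableSpace M] [BorelSpace M] [MulAction Γ M] [ContinuousSMul Γ M]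

/-- The atomic part of a stationary map is equivariant. The measure `ψ(p₊(x))` is the conditional
expectation of `w(T⁻¹x).ψ(p₊(T⁻¹x))`, and the `ℓ²` norms of the atomic parts of the two have the
same integral, since `T` preserves `m`. A conditional expectation in a Hilbert space that does not
decrease the mean square norm is the identity. -/
theorem IsStationary.atoms_seqShift {G : Greg X Γ} {ψ : (ℕ → Γ) → ProbabilityMeasure M}
    (h : G.IsStationary ψ) :
    ∀ᵐ y ∂G.futureMeasure, (ofProb (ψ (seqShift y))).atoms =
      translate (y 0) (ofProb (ψ y)).atoms := by
  have hψ : Measurable fun y => ofProb (ψ y) := measurable_ofProb.comp h.measurable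
  have hp := G.measurable_toFuture
  have hTs := G.T.symm.measurable
  have hmp : MeasurePreserving G.T.symm G.m G.m := G.measurePreserving.symm G.T
  let a : X → SubProb M := fun x => ofProb (ψ (G.toFuture x))
  let b : X → SubProb M := fun x => translate (G.w (G.T.symm x)) (a (G.T.symm x))
  have ha : Measurable a := hψ.comp hp
  have hb : Measurable b :=
    measurable_translate.comp ((G.measurable_w.comp hTs).prodMk (ha.comp hTs))
  have hbN : Measurable fun x =>
      translateProb (G.w (G.T.symm x)) (ψ (G.toFuture (G.T.symm x))) :=
    (measurable_subtype_coe.comp hb).subtype_mk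
  have hab : ∫⁻ x, pairing (b x) (a x) ∂G.m = ∫⁻ x, pairing (a x) (a x) ∂G.m := by
    simp only [← lintegral_singleton_mass]
    exact G.lintegral_of_isBarycenter hbN h.measurable h.stationary
      (F := fun y ξ => (ψ y : Measure M) {ξ})
      (measurable_singleton.comp ((hψ.comp measurable_fst).prodMk measurable_snd))
  have haa : Measurable fun x => pairing (a x) (a x) := measurable_pairing.comp (ha.prodMk ha)
  have hbb : ∫⁻ x, pairing (b x) (b x) ∂G.m = ∫⁻ x, pairing (a x) (a x) ∂G.m := by
    simp only [b, pairing_translate]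
    exact hmp.lintegral_comp haa
  have hbam : Measurable fun x => pairing (b x) (a x) := measurable_pairing.comp (hb.prodMk ha)
  have hbbm : Measurable fun x => pairing (b x) (b x) := measurable_pairing.comp (hb.prodMk hb)
  have hfin : ∫⁻ x, 2 * pairing (b x) (a x) ∂G.m ≠ ∞ := by
    refine ((lintegral_mono fun x =>
      mul_le_mul_right (pairing_le_one (b x) (a x)) 2).trans_lt ?_).ne
    simp
  have heq : ∀ᵐ x ∂G.m, 2 * pairing (b x) (a x) = pairing (b x) (b x) + pairing (a x) (a x) := by
    refine ae_eq_of_ae_le_of_lintegral_le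
      (Filter.Eventually.of_forall fun x => two_mul_pairing_le _ _) hfin
      (hbbm.add haa).aemeasurable (le_of_eq ?_)
    rw [lintegral_add_left hbbm, lintegral_const_mul _ hbam, hab, hbb, two_mul]
  have hshift : ∀ᵐ y ∂G.futureMeasure,
      2 * pairing (translate (y 0) (ofProb (ψ y))) (ofProb (ψ (seqShift y))) =
        pairing (translate (y 0) (ofProb (ψ y))) (translate (y 0) (ofProb (ψ y))) +
          pairing (ofProb (ψ (seqShift y))) (ofProb (ψ (seqShift y))) := by
    have hm1 : Measurable fun y : ℕ → Γ => translate (y 0) (ofProb (ψ y)) :=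
      measurable_translate.comp ((measurable_pi_apply 0).prodMk hψ)
    have hm2 : Measurable fun y : ℕ → Γ => ofProb (ψ (seqShift y)) := hψ.comp measurable_seqShift
    refine (ae_map_iff hp.aemeasurable (measurableSet_eq_fun
      ((measurable_pairing.comp (hm1.prodMk hm2)).const_mul 2)
      ((measurable_pairing.comp (hm1.prodMk hm1)).add
        (measurable_pairing.comp (hm2.prodMk hm2))))).2 ?_
    filter_upwards [G.measurePreserving.quasiMeasurePreserving.ae heq] with x hx
    simp only [a, b, G.T.symm_apply_apply] at hx
    exact hx
  filter_upwards [hshift] with y hy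
  rw [← atoms_translate]
  exact atoms_congr fun ξ => (singleton_eq_of_pairing_eq hy ξ).symm

end Greg

/-! ### Asymptotic independence of the atoms of the future and of the past -/

namespace Greg

open SubProb

variable {X Γ : Type*} [MeasurableSpace X] [StandardBorelSpace X] [MeasurableSpace Γ]
  [Group Γ] [TopologicalSpace Γ]
  {M : Type*} [TopologicalSpace M] [MeasurableSpace M] [BorelSpace M] [MulAction Γ M]
  [ContinuousSMul Γ M]

theorem IsPastEquivariant.ofProb_toPast {G : Greg X Γ} {φ : (ℕ → Γ) → ProbabilityMeasure M}
    (h : G.IsPastEquivariant φ) :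
    ∀ᵐ x ∂G.m, ofProb (φ (G.toPast (G.T x))) = translate (G.w x) (ofProb (φ (G.toPast x))) := by
  have h1 := ae_of_ae_map G.measurable_toPast.aemeasurable h.equivariant
  filter_upwards [G.measurePreserving.quasiMeasurePreserving.ae h1] with x hx
  rw [hx, ofProb_translateProb, toPast_T_zero, seqShift_toPast_T]

variable [BorelSpace Γ] [SecondCountableTopology Γ] [CompactSpace M]
  [TopologicalSpace.MetrizableSpace M]

/-- The pairing of the atoms of `ψ(p₊(x))` and `φ(p₋(x))` is `T`-invariant, and therefore a function
of the future. -/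
theorem IsStationary.exists_pairing_eq_comp_toFuture {G : Greg X Γ}
    {ψ φ : (ℕ → Γ) → ProbabilityMeasure M} (hψ : G.IsStationary ψ) (hφ : G.IsPastEquivariant φ) :
    ∃ h : (ℕ → Γ) → ℝ, Measurable h ∧ (∀ᵐ y ∂G.futureMeasure, h (seqShift y) = h y) ∧
      ∀ᵐ x ∂G.m,
        (pairing (ofProb (ψ (G.toFuture x))) (ofProb (φ (G.toPast x)))).toReal =
          h (G.toFuture x) := by
  let J : (ℕ → Γ) × (ℕ → Γ) → ℝ := fun p => (pairing (ofProb (ψ p.1)) (ofProb (φ p.2))).toReal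
  let f : X → ℝ := J ∘ fun x => (G.toFuture x, G.toPast x)
  have hJ : Measurable J :=
    (measurable_pairing.comp (((measurable_ofProb.comp hψ.measurable).comp measurable_fst).prodMk
      ((measurable_ofProb.comp hφ.measurable).comp measurable_snd))).ennreal_toReal
  have hfT : ∀ᵐ x ∂G.m, f (G.T x) = f x := by
    filter_upwards [ae_of_ae_map G.measurable_toFuture.aemeasurable hψ.atoms_seqShift,
      hφ.ofProb_toPast] with x hx hx'
    have hsing (ξ : M) : (ofProb (ψ (G.toFuture (G.T x)))).1 {ξ} =
        (translate (G.w x) (ofProb (ψ (G.toFuture x)))).1 {ξ} := by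
      rw [← atoms_singleton, toFuture_T, hx, translate_singleton, atoms_singleton,
        translate_singleton, toFuture_zero]
    simp only [f, J, Function.comp]
    rw [hx', pairing_congr hsing fun _ => rfl, pairing_translate]
  have hf : Measurable f := hJ.comp (G.measurable_toFuture.prodMk G.measurable_toPast)
  have hint : Integrable f G.m := by
    refine Integrable.of_bound hf.aestronglyMeasurable 1 (Filter.Eventually.of_forall fun x => ?_)
    change ‖(pairing _ _).toReal‖ ≤ 1
    rw [Real.norm_of_nonneg ENNReal.toReal_nonneg]
    exact ENNReal.toReal_le_of_le_ofReal zero_le_one (by simpa using pairing_le_one _ _)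
  have hfm := hJ.comp (G.measurable_toFuture_iSup.prodMk G.measurable_toPast_iSup)
  obtain ⟨h, hhm, hh⟩ := exists_ae_eq_comp_of_invariant G.measurePreserving G.measurable_toFuture
    measurable_seqShift G.toFuture_T hint hfT hfm
  refine ⟨h, hhm, ?_, hh⟩
  refine (ae_map_iff G.measurable_toFuture.aemeasurable
    (measurableSet_eq_fun (hhm.comp measurable_seqShift) hhm)).2 ?_
  filter_upwards [hfT, hh, G.measurePreserving.quasiMeasurePreserving.ae hh] with x h1 h2 h3
  change h (seqShift (G.toFuture x)) = h (G.toFuture x)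
  rw [← toFuture_T, ← h2, ← h3]
  exact h1

variable [IsTopologicalGroup Γ]

theorem map_futureIncrements (G : Greg X Γ) (κ : Measure Γ) [IsProbabilityMeasure κ] :
    ((G.walkLaw κ).map futurePart).map futureIncrements = G.futureMeasure := by
  rw [walkLaw, Measure.map_map measurable_futurePart G.measurable_walk,
    Measure.map_map measurable_futureIncrements (measurable_futurePart.comp G.measurable_walk)]
  have : futureIncrements ∘ futurePart ∘ G.walk = G.toFuture ∘ Prod.fst :=
    funext G.futureIncrements_walk
  rw [this, ← Measure.map_map G.measurable_toFuture measurable_fst, ← Measure.fst,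
    Measure.fst_prod, futureMeasure]

theorem map_pastIncrements (G : Greg X Γ) (κ : Measure Γ) [IsProbabilityMeasure κ] :
    ((G.walkLaw κ).map pastPart).map pastIncrements = G.pastMeasure := by
  have hmp : MeasurePreserving G.T.symm G.m G.m := G.measurePreserving.symm G.T
  rw [walkLaw, Measure.map_map measurable_pastPart G.measurable_walk,
    Measure.map_map measurable_pastIncrements (measurable_pastPart.comp G.measurable_walk)]
  have : pastIncrements ∘ pastPart ∘ G.walk = (G.toPast ∘ G.T.symm) ∘ Prod.fst :=
    funext G.pastIncrements_walk
  rw [this, ← Measure.map_map (G.measurable_toPast.comp hmp.measurable) measurable_fst,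
    ← Measure.fst, Measure.fst_prod, ← Measure.map_map G.measurable_toPast hmp.measurable,
    hmp.map_eq, pastMeasure]

variable [LocallyCompactSpace Γ]

/-- The consequence of asymptotic independence: the atoms of `ψ(p₊(x))` and of an independent,
randomly translated copy of `φ` always have the same pairing as the atoms of `ψ(p₊(x))` and
`φ(p₋(x))`. The translate of the atomic part of `ψ(p₊(x))` is a function of the ideal future, and so
is the pairing itself; the translate of `φ(p₋(x))` is a function of the ideal past. Only the random
translation of the copy matters later, so the two measures are recorded as unspecified `μ`, `ν`. -/
theorem IsApafic.exists_pairing_translate_eq {G : Greg X Γ} (hG : G.IsApafic)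
    {ψ φ : (ℕ → Γ) → ProbabilityMeasure M} (hψ : G.IsStationary ψ) (hφ : G.IsPastEquivariant φ) :
    ∃ κ : Measure Γ, Measure.haar ≪ κ ∧ ∀ᵐ x ∂G.m, ∃ μ ν : SubProb M, ∀ᵐ g ∂κ,
      pairing μ (translate g ν) =
        pairing (ofProb (ψ (G.toFuture x))) (ofProb (φ (G.toPast x))) := by
  obtain ⟨κ, Ep, Em, _, _, βp, βm, hκ, -, hhaar, -, -, hp, hm, -, hac⟩ := hG
  refine ⟨κ, hhaar, ?_⟩
  obtain ⟨h, hhm, hhS, hh⟩ := hψ.exists_pairing_eq_comp_toFuture hφ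
  have hwalk := G.measurable_walk
  have : IsProbabilityMeasure (G.walkLaw κ) := Measure.isProbabilityMeasure_map hwalk.aemeasurable
  -- The first entry of the path `(w_n(x) g⁻¹)` recovers `g`, and the increments recover the future
  -- of `x`, or the past of `T⁻¹ x`. So the maps below are `g.ψ(p₊(x))` (atomic part) and
  -- `g.φ(p₋(x))` in terms of paths.
  let u₁ : (ℕ → Γ) → SubProb M × ℝ := fun γ =>
    (translate (γ 0)⁻¹ (ofProb (ψ (futureIncrements γ))).atoms, h (futureIncrements γ))
  let u₂ : (ℕ → Γ) → SubProb M := fun γ =>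
    translate (γ 0)⁻¹ (ofProb (φ (pastIncrements γ)))
  have hu₁ : Measurable u₁ :=
    (measurable_translate.comp ((measurable_pi_apply 0).inv.prodMk (measurable_atoms.comp
      (measurable_ofProb.comp (hψ.measurable.comp measurable_futureIncrements))))).prodMk
        (hhm.comp measurable_futureIncrements)
  have hu₂ : Measurable u₂ :=
    measurable_translate.comp ((measurable_pi_apply 0).inv.prodMk
      (measurable_ofProb.comp (hφ.measurable.comp measurable_pastIncrements)))
  have hS₁ : ∀ᵐ γ ∂(G.walkLaw κ).map futurePart, u₁ (seqShift γ) = u₁ γ := by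
    have h1 := hψ.atoms_seqShift
    have h2 := hhS
    rw [← G.map_futureIncrements κ] at h1 h2
    filter_upwards [ae_of_ae_map measurable_futureIncrements.aemeasurable h1,
      ae_of_ae_map measurable_futureIncrements.aemeasurable h2] with γ h1 h2
    have e : futureIncrements (seqShift γ) = seqShift (futureIncrements γ) := rfl
    refine Prod.ext ?_ ?_
    · simp only [u₁]
      rw [e, h1, ← translate_mul]
      simp [seqShift, futureIncrements]
    · simp only [u₁]
      rw [e, h2]
  have hS₂ : ∀ᵐ γ ∂(G.walkLaw κ).map pastPart, u₂ (seqShift γ) = u₂ γ := by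
    have h1 := hφ.equivariant
    rw [← G.map_pastIncrements κ] at h1
    filter_upwards [ae_of_ae_map measurable_pastIncrements.aemeasurable h1] with γ h1
    have e : pastIncrements (seqShift γ) = seqShift (pastIncrements γ) := rfl
    simp only [u₂]
    rw [e, h1, ofProb_translateProb, ← translate_mul]
    simp [seqShift, pastIncrements]
  let D : Set ((SubProb M × ℝ) × SubProb M) := {z | (pairing z.1.1 z.2).toReal = z.1.2}
  have hD : MeasurableSet D := measurableSet_eq_fun
    (measurable_pairing.comp ((measurable_fst.comp measurable_fst).prodMk
      measurable_snd)).ennreal_toReal (measurable_snd.comp measurable_fst)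
  have hu₁walk (p : X × Γ) : u₁ (futurePart (G.walk p)) =
      (translate p.2 (ofProb (ψ (G.toFuture p.1))).atoms, h (G.toFuture p.1)) := by
    simp only [u₁, futureIncrements_walk, futurePart_walk, natCocycle, one_mul, inv_inv]
  have hu₂walk (p : X × Γ) : u₂ (pastPart (G.walk p)) =
      translate p.2 (translate (G.w (G.T.symm p.1)) (ofProb (φ (G.toPast (G.T.symm p.1))))) := by
    simp only [u₂, pastIncrements_walk, pastPart_walk_zero, translate_mul]
  have hjoint : ∀ᵐ γ ∂G.walkLaw κ, (u₁ (futurePart γ), u₂ (pastPart γ)) ∈ D := by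
    have hpast := (G.measurePreserving.symm G.T).quasiMeasurePreserving.ae hφ.ofProb_toPast
    refine (ae_map_iff hwalk.aemeasurable (((hu₁.comp measurable_futurePart).prodMk
      (hu₂.comp measurable_pastPart)) hD)).2 ?_
    filter_upwards [Measure.quasiMeasurePreserving_fst.ae hpast,
      Measure.quasiMeasurePreserving_fst.ae hh] with p hp1 hp2
    change (pairing (u₁ (futurePart (G.walk p))).1 (u₂ (pastPart (G.walk p)))).toReal =
      (u₁ (futurePart (G.walk p))).2
    rw [hu₁walk, hu₂walk, ← hp1, G.T.apply_symm_apply, pairing_translate,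
      pairing_congr (atoms_singleton _) fun _ => rfl]
    exact hp2
  have hprod := ae_prod_of_ae_of_isErgodicComponents measurable_futurePart measurable_pastPart
    hp hm hac hu₁ hu₂ hS₁ hS₂ hD hjoint
  have hfw := measurable_futurePart.comp hwalk
  have hpw := measurable_pastPart.comp hwalk
  rw [walkLaw, Measure.map_map measurable_futurePart hwalk,
    Measure.map_map measurable_pastPart hwalk, Measure.map_prod_map _ _ hfw hpw] at hprod
  have hprod' := ae_of_ae_map (hfw.prodMap hpw).aemeasurable hprod
  filter_upwards [Measure.ae_ae_of_ae_prod (Measure.ae_ae_of_ae_prod hprod'), hh] with x hx hhx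
  obtain ⟨g, hg⟩ := hx.exists
  obtain ⟨x', hx'⟩ := (Measure.ae_ae_of_ae_prod hg).exists
  refine ⟨translate g (ofProb (ψ (G.toFuture x))).atoms,
    translate (G.w (G.T.symm x')) (ofProb (φ (G.toPast (G.T.symm x')))),
    hx'.mono fun g' hg' => ?_⟩
  have hD' : (pairing (u₁ (futurePart (G.walk (x, g)))).1
      (u₂ (pastPart (G.walk (x', g'))))).toReal = (u₁ (futurePart (G.walk (x, g)))).2 := hg'
  rw [hu₁walk, hu₂walk] at hD'
  exact (ENNReal.toReal_eq_toReal_iff' (pairing_ne_top _ _) (pairing_ne_top _ _)).1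
    (hD'.trans hhx.symm)

end Greg

end

open SubProb
open scoped ENNReal

theorem propositionp
    {X Γ M : Type*} [MeasurableSpace X] [StandardBorelSpace X]
    [Group Γ] [TopologicalSpace Γ] [IsTopologicalGroup Γ] [LocallyCompactSpace Γ]
    [SecondCountableTopology Γ] [T2Space Γ] [MeasurableSpace Γ] [BorelSpace Γ]
    (G : Greg X Γ) (hG : G.IsApafic)
    [TopologicalSpace M] [CompactSpace M] [TopologicalSpace.MetrizableSpace M]
    [MeasurableSpace M] [BorelSpace M] [MulAction Γ M] [ContinuousSMul Γ M]
    (hM : ¬ ∃ F : Set M, F.Finite ∧ F.Nonempty ∧ ∀ γ : Γ, ∀ ξ ∈ F, γ • ξ ∈ F)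
    (ψ : (ℕ → Γ) → ProbabilityMeasure M) (hψ : G.IsPastOriented ψ) :
    ∀ᵐ y ∂G.futureMeasure, ∀ ξ : M, (ψ y : Measure M) {ξ} = 0 := by
  obtain ⟨φ, hφ, hbar⟩ := hψ.exists_past
  have hψm := measurable_ofProb.comp hψ.isStationary.measurable
  have hself : Measurable fun y => pairing (ofProb (ψ y)) (ofProb (ψ y)) :=
    measurable_pairing.comp (hψm.prodMk hψm)
  obtain ⟨κ, hκ, hx⟩ := hG.exists_pairing_translate_eq hψ.isStationary hφ
  have hzero : ∀ᵐ x ∂G.m,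
      pairing (ofProb (φ (G.toPast x))) (ofProb (ψ (G.toFuture x))) = 0 := by
    filter_upwards [hx] with x ⟨μ, ν, h⟩
    rw [pairing_comm]
    set c := pairing (ofProb (ψ (G.toFuture x))) (ofProb (φ (G.toPast x)))
    by_contra hc
    have hc' : c ≠ ∞ := pairing_ne_top _ _
    -- The pairing is at most `c / 2 < c` on a non-empty open set, which is not a null set.
    obtain ⟨U, hU, hne, hle⟩ := exists_isOpen_pairing_translate_le (Γ := Γ)
      (infinite_orbit_of_no_finite_invariant hM) μ ν
      (ε := c / 2 / 2) (by simp [pos_iff_ne_zero, ENNReal.div_eq_zero_iff, hc])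
    refine (hU.measure_pos Measure.haar hne).ne' (hκ ?_)
    refine measure_mono_null (fun g hg => ?_) (ae_iff.1 h)
    refine ((hle g hg).trans_lt ?_).ne
    rw [ENNReal.mul_div_cancel (by simp) (by simp)]
    exact ENNReal.half_lt_self hc hc'
  have hint : ∫⁻ x, pairing (ofProb (ψ (G.toFuture x))) (ofProb (ψ (G.toFuture x))) ∂G.m = 0 := by
    have hav := G.lintegral_of_isBarycenter (hφ.measurable.comp G.measurable_toPast)
      hψ.isStationary.measurable hbar (F := fun y ξ => (ψ y : Measure M) {ξ})
      (measurable_singleton.comp ((hψm.comp measurable_fst).prodMk measurable_snd))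
    simp only [← lintegral_singleton_mass] at hzero ⊢
    exact hav.symm.trans (lintegral_eq_zero_of_ae_eq_zero hzero)
  have hnull : ∀ᵐ y ∂G.futureMeasure, pairing (ofProb (ψ y)) (ofProb (ψ y)) = 0 :=
    (ae_map_iff G.measurable_toFuture.aemeasurable (measurableSet_eq_fun hself measurable_const)).2
      ((lintegral_eq_zero_iff (hself.comp G.measurable_toFuture)).1 hint)
  filter_upwards [hnull] with y hy ξ
  simpa using ENNReal.tsum_eq_zero.1 hy ξ
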